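/- Let $V:\mathbb R\to\mathbb R$ be a non-negative function of class $C^3$. Let $$\Omega=\{(K,\phi,\dot\phi)\in\mathbb R^3:\ K>0,\ K^2=3V(\phi)+\tfrac32\dot\phi^2\},$$ the phase space of expanding spatially flat FRW scalar field cosmologies with potential $V$, let $x=1/K$, $y=\sqrt{3/2}\,\dot\phi/K$, and consider on $\Omega$ the dynamical system $$\frac{dx}{d\tau}=y^2x,\qquad \frac{dy}{d\tau}=-y-\sqrt{\tfrac32}\,x^2V'(\phi)+y^3,\qquad \frac{d\phi}{d\tau}=\sqrt{\tfrac23}\,y .$$ For $p\in\Omega$ let $O^-(p)$ be the past orbit of $p$, i.e. the set of states $\gamma(\tau)$, $\tau\le 0$, of the solution $\gamma$ with $\gamma(0)=p$. Then $\phi$ is unbounded on $O^-(p)$ for almost every $p\in\Omega$. That is, the set of $p\in\Omega$ for which $\phi$ is bounded on $O^-(p)$ has two-dimensional (Hausdorff) measure zero. Moreover, if $p\in\Omega$ and $\phi$ is bounded on $O^-(p)$, then the solution through $p$ exists for all $\tau\le 0$ and converges in $\Omega$, as $\tau\to-\infty$, to a de Sitter equilibrium, i.e. to an equilibrium point $(K,\phi,\dot\phi)=(\sqrt{3V(\phi_0)},\phi_0,0)$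 with $V(\phi_0)>0$ and $V'(\phi_0)=0$. -/

import Mathlib

open MeasureTheory Filter Topology

noncomputable section

namespace FlatFRW

/-- The ambient space `ℝ³` of triples `(K, φ, φ')`: expansion, scalar field, and derivative of the
scalar field with respect to cosmological time. -/
abbrev State : Type := EuclideanSpace ℝ (Fin 3)

/-- The expansion `K`. -/
def expansion (p : State) : ℝ := p 0

/-- The scalar field `φ`. -/
def field (p : State) : ℝ := p 1

/-- The derivative of the scalar field with respect to cosmological time `t`. -/
def velocity (p : State) : ℝ := p 2

/-- The phase space `Ω` of physical expanding solutions: `K > 0` and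
`K² = 3 V(φ) + (3/2) (dφ/dt)²`. -/
def phaseSpace (V : ℝ → ℝ) : Set State :=
  {p | 0 < expansion p ∧ expansion p ^ 2 = 3 * V (field p) + 3 / 2 * velocity p ^ 2}

/-- The coordinate `x = 1 / K`. -/
def xCoord (p : State) : ℝ := 1 / expansion p

/-- The coordinate `y = √(3/2) (dφ/dt) / K`. -/
def yCoord (p : State) : ℝ := √(3 / 2) * velocity p / expansion p

/-- `dx/dτ = y² x`. -/
def xRate (p : State) : ℝ := yCoord p ^ 2 * xCoord p

/-- `dy/dτ = - y - √(3/2) x² V'(φ) + y³`. -/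
def yRate (V : ℝ → ℝ) (p : State) : ℝ :=
  - yCoord p - √(3 / 2) * xCoord p ^ 2 * deriv V (field p) + yCoord p ^ 3

/-- `dφ/dτ = √(2/3) y`. -/
def fieldRate (p : State) : ℝ := √(2 / 3) * yCoord p

/-- `γ` is a solution on the time interval `I` of the dynamical system for `(x, y, φ)` in the time
`τ`, subject to the constraint (it runs in `Ω`). Derivatives at an end point of `I` that belongs
to `I` are one-sided. -/
structure IsSolutionOn (V : ℝ → ℝ) (γ : ℝ → State) (I : Set ℝ) : Prop where
  mem : ∀ τ ∈ I, γ τ ∈ phaseSpace V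
  x_eq : ∀ τ ∈ I, HasDerivWithinAt (fun s => xCoord (γ s)) (xRate (γ τ)) I τ
  y_eq : ∀ τ ∈ I, HasDerivWithinAt (fun s => yCoord (γ s)) (yRate V (γ τ)) I τ
  field_eq : ∀ τ ∈ I, HasDerivWithinAt (fun s => field (γ s)) (fieldRate (γ τ)) I τ

/-- The past orbit `O⁻(p)`: all states `γ T` with `T ≤ 0` reached by following backwards in time
a solution `γ` with `γ 0 = p`. -/
def pastOrbit (V : ℝ → ℝ) (p : State) : Set State :=
  {q | ∃ T ≤ (0 : ℝ), ∃ γ : ℝ → State,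
    IsSolutionOn V γ (Set.Icc T 0) ∧ γ 0 = p ∧ γ T = q}

/-- `φ` is bounded on the past orbit of `p`. -/
def FieldBoundedOnPast (V : ℝ → ℝ) (p : State) : Prop :=
  ∃ M : ℝ, ∀ q ∈ pastOrbit V p, |field q| ≤ M

/-- An equilibrium point in `Ω`: the right-hand sides of all three equations vanish. -/
def IsEquilibrium (V : ℝ → ℝ) (q : State) : Prop :=
  q ∈ phaseSpace V ∧ xRate q = 0 ∧ yRate V q = 0 ∧ fieldRate q = 0

/-- The solution through `p` exists for all past times and tends to `q` as `τ → -∞`. -/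
def PastAsymptotic (V : ℝ → ℝ) (p q : State) : Prop :=
  ∃ γ : ℝ → State, IsSolutionOn V γ (Set.Iic 0) ∧ γ 0 = p ∧ Tendsto γ atBot (𝓝 q)

end FlatFRW

end

/-! In the coordinates `(log x, y, φ)` the phase space is the level set `constraint V = 1`, and `V ≥
0` forces `|y| ≤ 1` there. So `log x` and `φ` move at speed at most 1, nothing blows up in finite
past time, and every past orbit is complete (`exists_trajectory_Iic`).

Suppose `φ` stays bounded in the past. Since `log x` is nondecreasing in `τ`, it has a limit in the
past or tends to `-∞`. In the latter case the potential term of the constraint vanishes, `y²` tends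
to 1 and `φ` drifts without bound, which is absurd. So `log x` converges, Barbalat's lemma gives `y
→ 0`, and the constraint makes `V(φ)` converge. If `φ` oscillated, `V` would be constant on an
interval crossed infinitely often, the orbit would meet an equilibrium there, and uniqueness would
freeze it. Hence the orbit converges, and its limit is a de Sitter equilibrium
(`IsTrajectoryOn.exists_tendsto`).

For the null set, the constraint removes `x` near such an equilibrium and leaves a planar system for
`(y, φ)` whose linearization has trace `-1`, hence at most one direction that does not contract
forwards in time. A quadratic form shows that the difference of two orbits with nearby pasts lies in
a cone around the `φ` direction, whatever the sign of `V''`, zero included (`exists_cone_bound`).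
The states with trapped pasts thus lie on a Lipschitz curve (`exists_local_past_bound`). The forward
flow is Lipschitz on bounded sets, so it carries these curves to sets of zero two-dimensional
measure, and countably many of them suffice. -/

namespace FlatFRW

/-! ### The chart `(log x, y, φ)` -/

/-- The vector field of the dynamical system in the coordinates `(log x, y, φ)`. -/
noncomputable def chartField (V : ℝ → ℝ) (z : ℝ × ℝ × ℝ) : ℝ × ℝ × ℝ :=
  (z.2.1 ^ 2,
    - z.2.1 - √(3 / 2) * Real.exp (2 * z.1) * deriv V z.2.2 + z.2.1 ^ 3,
    √(2 / 3) * z.2.1)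

/-- The function of `(log x, y, φ)` that equals `1` on the phase space. -/
noncomputable def constraint (V : ℝ → ℝ) (z : ℝ × ℝ × ℝ) : ℝ :=
  3 * V z.2.2 * Real.exp (2 * z.1) + z.2.1 ^ 2

/-- The state with coordinates `(log x, y, φ)`. -/
noncomputable def toState (z : ℝ × ℝ × ℝ) : State :=
  !₂[Real.exp (-z.1), z.2.2, √(2 / 3) * z.2.1 * Real.exp (-z.1)]

/-- The coordinates `(log x, y, φ)` of a state. -/
noncomputable def chart (p : State) : ℝ × ℝ × ℝ :=
  (Real.log (xCoord p), yCoord p, field p)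

lemma sqrt_mul_sqrt : √(3 / 2 : ℝ) * √(2 / 3 : ℝ) = 1 := by
  rw [← Real.sqrt_mul (by norm_num)]; norm_num

lemma sqrt_two_thirds_sq : √(2 / 3 : ℝ) ^ 2 = 2 / 3 := Real.sq_sqrt (by norm_num)

lemma sqrt_two_thirds_le_one : √(2 / 3 : ℝ) ≤ 1 :=
  Real.sqrt_le_one.2 (by norm_num)

lemma sqrt_two_thirds_pos : 0 < √(2 / 3 : ℝ) := Real.sqrt_pos.2 (by norm_num)

lemma sqrt_three_halves_pos : 0 < √(3 / 2 : ℝ) := Real.sqrt_pos.2 (by norm_num)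

lemma sqrt_three_halves_eq : √(3 / 2 : ℝ) = 3 / 2 * √(2 / 3 : ℝ) := by
  have h1 := sqrt_mul_sqrt
  have h2 := sqrt_two_thirds_sq
  have h3 := sqrt_two_thirds_pos
  apply mul_right_cancel₀ h3.ne'
  nlinarith

@[simp] lemma expansion_toState (z : ℝ × ℝ × ℝ) : expansion (toState z) = Real.exp (-z.1) := rfl

@[simp] lemma field_toState (z : ℝ × ℝ × ℝ) : field (toState z) = z.2.2 := rfl

@[simp] lemma velocity_toState (z : ℝ × ℝ × ℝ) :
    velocity (toState z) = √(2 / 3) * z.2.1 * Real.exp (-z.1) := rfl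

@[simp] lemma xCoord_toState (z : ℝ × ℝ × ℝ) : xCoord (toState z) = Real.exp z.1 := by
  simp [xCoord, Real.exp_neg]

@[simp] lemma yCoord_toState (z : ℝ × ℝ × ℝ) : yCoord (toState z) = z.2.1 := by
  have h := (Real.exp_pos (-z.1)).ne'
  rw [yCoord, velocity_toState, expansion_toState, ← mul_assoc, mul_div_cancel_right₀ _ h,
    ← mul_assoc, sqrt_mul_sqrt, one_mul]

lemma toState_mem_phaseSpace (V : ℝ → ℝ) (z : ℝ × ℝ × ℝ) :
    toState z ∈ phaseSpace V ↔ constraint V z = 1 := by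
  have h := Real.exp_pos z.1
  have h2 : Real.exp (2 * z.1) = Real.exp z.1 ^ 2 := by rw [← Real.exp_nat_mul]; norm_num
  simp only [phaseSpace, Set.mem_ofPred_eq, expansion_toState, field_toState, velocity_toState,
    constraint, Real.exp_neg, h2, mul_pow, sqrt_two_thirds_sq]
  constructor
  · rintro ⟨-, h3⟩
    field_simp at h3
    linarith
  · intro h3
    refine ⟨by positivity, ?_⟩
    field_simp
    linarith

lemma xCoord_pos {V : ℝ → ℝ} {p : State} (hp : p ∈ phaseSpace V) : 0 < xCoord p :=
  one_div_pos.2 hp.1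

lemma toState_chart {V : ℝ → ℝ} {p : State} (hp : p ∈ phaseSpace V) : toState (chart p) = p := by
  have h : 0 < p 0 := hp.1
  have h1 : Real.exp (-(Real.log (xCoord p))) = p 0 := by
    rw [Real.exp_neg, Real.exp_log (xCoord_pos hp)]
    simp [xCoord, expansion]
  ext i
  fin_cases i
  · exact h1
  · rfl
  · change √(2 / 3) * yCoord p * Real.exp (-(Real.log (xCoord p))) = p 2
    rw [h1, yCoord]
    simp only [velocity, expansion]
    field_simp
    linear_combination (p 2) * sqrt_mul_sqrt

lemma constraint_chart {V : ℝ → ℝ} {p : State} (hp : p ∈ phaseSpace V) :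
    constraint V (chart p) = 1 := by
  rwa [← toState_mem_phaseSpace, toState_chart hp]

lemma hasDerivWithinAt_fst {E F : Type*} [NormedAddCommGroup E] [NormedSpace ℝ E]
    [NormedAddCommGroup F] [NormedSpace ℝ F] {z : ℝ → E × F} {z' : E × F} {I : Set ℝ} {τ : ℝ}
    (h : HasDerivWithinAt z z' I τ) : HasDerivWithinAt (fun s => (z s).1) z'.1 I τ := by
  simpa using h.hasFDerivWithinAt.fst.hasDerivWithinAt

lemma hasDerivWithinAt_snd {E F : Type*} [NormedAddCommGroup E] [NormedSpace ℝ E]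
    [NormedAddCommGroup F] [NormedSpace ℝ F] {z : ℝ → E × F} {z' : E × F} {I : Set ℝ} {τ : ℝ}
    (h : HasDerivWithinAt z z' I τ) : HasDerivWithinAt (fun s => (z s).2) z'.2 I τ := by
  simpa using h.hasFDerivWithinAt.snd.hasDerivWithinAt

lemma isSolutionOn_toState {V : ℝ → ℝ} {z : ℝ → ℝ × ℝ × ℝ} {I : Set ℝ}
    (hz : ∀ τ ∈ I, HasDerivWithinAt z (chartField V (z τ)) I τ)
    (hc : ∀ τ ∈ I, constraint V (z τ) = 1) :
    IsSolutionOn V (fun τ => toState (z τ)) I where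
  mem τ hτ := (toState_mem_phaseSpace V _).2 (hc τ hτ)
  x_eq τ hτ := by
    simp only [xRate, xCoord_toState, yCoord_toState]
    have := (hasDerivWithinAt_fst (hz τ hτ)).exp
    rwa [mul_comm] at this
  y_eq τ hτ := by
    simp only [yRate, xCoord_toState, yCoord_toState, field_toState, ← Real.exp_nat_mul]
    exact_mod_cast hasDerivWithinAt_fst (hasDerivWithinAt_snd (hz τ hτ))
  field_eq τ hτ := by
    simp only [fieldRate, yCoord_toState, field_toState]
    exact hasDerivWithinAt_snd (hasDerivWithinAt_snd (hz τ hτ))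

lemma contDiff_chartField {V : ℝ → ℝ} (hV : ContDiff ℝ 3 V) : ContDiff ℝ 1 (chartField V) := by
  have : ContDiff ℝ 1 (deriv V) := (hV.of_le (by norm_num : (1 + 1 : WithTop ℕ∞) ≤ 3)).deriv'
  unfold chartField
  fun_prop

lemma contDiff_toState : ContDiff ℝ 1 toState := by
  unfold toState
  rw [contDiff_euclidean]
  intro i
  fin_cases i <;> simp <;> fun_prop

/-! ### Uniqueness and Lipschitz dependence of trajectories -/

/-- A trajectory of the system in the coordinates `(log x, y, φ)` for the potential `V`. -/
def IsTrajectoryOn (V : ℝ → ℝ) (z : ℝ → ℝ × ℝ × ℝ) (I : Set ℝ) : Prop :=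
  ∀ τ ∈ I, HasDerivWithinAt z (chartField V (z τ)) I τ

lemma IsTrajectoryOn.mono {V : ℝ → ℝ} {z : ℝ → ℝ × ℝ × ℝ} {I J : Set ℝ}
    (h : IsTrajectoryOn V z I) (hJ : J ⊆ I) : IsTrajectoryOn V z J :=
  fun τ hτ => (h τ (hJ hτ)).mono hJ

lemma IsTrajectoryOn.continuousOn {V : ℝ → ℝ} {z : ℝ → ℝ × ℝ × ℝ} {I : Set ℝ}
    (h : IsTrajectoryOn V z I) : ContinuousOn z I :=
  fun τ hτ => (h τ hτ).continuousWithinAt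

lemma exists_lipschitzOnWith_closedBall {F : Type*} [NormedAddCommGroup F] [NormedSpace ℝ F]
    {f : ℝ × ℝ × ℝ → F} (hf : ContDiff ℝ 1 f) (R : ℝ) :
    ∃ K, LipschitzOnWith K f (Metric.closedBall 0 R) :=
  hf.contDiffOn.exists_lipschitzOnWith one_ne_zero (convex_closedBall 0 R)
    (isCompact_closedBall 0 R)

lemma IsTrajectoryOn.exists_norm_le {V : ℝ → ℝ} {z : ℝ → ℝ × ℝ × ℝ} {a b : ℝ}
    (h : IsTrajectoryOn V z (Set.Icc a b)) :
    ∃ R, ∀ τ ∈ Set.Icc a b, z τ ∈ Metric.closedBall 0 R := by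
  obtain ⟨R, hR⟩ := isCompact_Icc.exists_bound_of_continuousOn h.continuousOn
  exact ⟨R, fun τ hτ => by simpa using hR τ hτ⟩

/-- Backward uniqueness of trajectories. -/
lemma IsTrajectoryOn.eqOn {V : ℝ → ℝ} (hV : ContDiff ℝ 3 V) {z w : ℝ → ℝ × ℝ × ℝ} {a b : ℝ}
    (hz : IsTrajectoryOn V z (Set.Icc a b)) (hw : IsTrajectoryOn V w (Set.Icc a b))
    (h : z b = w b) : Set.EqOn z w (Set.Icc a b) := by
  obtain ⟨R, hR⟩ := hz.exists_norm_le
  obtain ⟨S, hS⟩ := hw.exists_norm_le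
  obtain ⟨K, hK⟩ := exists_lipschitzOnWith_closedBall (contDiff_chartField hV) (max R S)
  have key : ∀ {z : ℝ → ℝ × ℝ × ℝ}, IsTrajectoryOn V z (Set.Icc a b) → ∀ t ∈ Set.Ioc a b,
      HasDerivWithinAt z (chartField V (z t)) (Set.Iic t) t := fun hz t ht =>
    (hz t ⟨ht.1.le, ht.2⟩).mono_of_mem_nhdsWithin
      (mem_of_superset (Icc_mem_nhdsLE ht.1) (Set.Icc_subset_Icc_right ht.2))
  exact ODE_solution_unique_of_mem_Icc_left (v := fun _ => chartField V)
    (s := fun _ => Metric.closedBall 0 (max R S)) (fun t _ => hK) hz.continuousOn (key hz)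
    (fun t ht => Metric.closedBall_subset_closedBall (le_max_left _ _) (hR t ⟨ht.1.le, ht.2⟩))
    hw.continuousOn (key hw)
    (fun t ht => Metric.closedBall_subset_closedBall (le_max_right _ _) (hS t ⟨ht.1.le, ht.2⟩)) h

/-- Trajectories that stay in a ball depend on their initial point in a Lipschitz way. -/
lemma exists_dist_trajectory_le {V : ℝ → ℝ} (hV : ContDiff ℝ 3 V) (R T : ℝ) :
    ∃ K : NNReal, ∀ a b, a ≤ b → b - a ≤ T → ∀ z w : ℝ → ℝ × ℝ × ℝ,
      IsTrajectoryOn V z (Set.Icc a b) → IsTrajectoryOn V w (Set.Icc a b) →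
      (∀ τ ∈ Set.Icc a b, z τ ∈ Metric.closedBall 0 R) →
      (∀ τ ∈ Set.Icc a b, w τ ∈ Metric.closedBall 0 R) →
      dist (z b) (w b) ≤ K * dist (z a) (w a) := by
  obtain ⟨K, hK⟩ := exists_lipschitzOnWith_closedBall (contDiff_chartField hV) R
  refine ⟨⟨Real.exp (K * T), (Real.exp_pos _).le⟩, fun a b hab hT z w hz hw hzR hwR => ?_⟩
  have key : ∀ {z : ℝ → ℝ × ℝ × ℝ}, IsTrajectoryOn V z (Set.Icc a b) → ∀ t ∈ Set.Ico a b,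
      HasDerivWithinAt z (chartField V (z t)) (Set.Ici t) t := fun hz t ht =>
    (hz t ⟨ht.1, ht.2.le⟩).mono_of_mem_nhdsWithin
      (mem_of_superset (Icc_mem_nhdsGE ht.2) (Set.Icc_subset_Icc_left ht.1))
  have := dist_le_of_trajectories_ODE_of_mem (v := fun _ => chartField V)
    (s := fun _ => Metric.closedBall 0 R) (fun t _ => hK) hz.continuousOn (key hz)
    (fun t ht => hzR t ⟨ht.1, ht.2.le⟩) hw.continuousOn (key hw)
    (fun t ht => hwR t ⟨ht.1, ht.2.le⟩) le_rfl b ⟨hab, le_rfl⟩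
  refine this.trans ?_
  rw [mul_comm]
  gcongr
  change Real.exp (K * (b - a)) ≤ Real.exp (K * T)
  gcongr

/-! ### Past completeness by truncating the vector field -/

/-- The nearest point to `t` in `[-R, R]`. -/
def clamp (R t : ℝ) : ℝ := max (-R) (min R t)

lemma clamp_of_abs_le {R t : ℝ} (h : |t| ≤ R) : clamp R t = t := by
  obtain ⟨h1, h2⟩ := abs_le.1 h
  simp [clamp, h1, h2]

lemma abs_clamp_le {R : ℝ} (hR : 0 ≤ R) (t : ℝ) : |clamp R t| ≤ R :=
  abs_le.2 ⟨le_max_left _ _, max_le (by linarith) (min_le_left _ _)⟩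

lemma lipschitzWith_clamp (R : ℝ) : LipschitzWith 1 (clamp R) :=
  (LipschitzWith.id.const_min R).const_max (-R)

/-- The nearest point to `z` in the box `[-R, R] × [-1, 1] × [-R, R]`. -/
def truncate (R : ℝ) (z : ℝ × ℝ × ℝ) : ℝ × ℝ × ℝ :=
  (clamp R z.1, clamp 1 z.2.1, clamp R z.2.2)

lemma truncate_mem {R : ℝ} (hR : 1 ≤ R) (z : ℝ × ℝ × ℝ) :
    truncate R z ∈ Metric.closedBall 0 R := by
  have h0 : 0 ≤ R := by linarith
  simp only [mem_closedBall_zero_iff, Prod.norm_def, Real.norm_eq_abs, truncate, max_le_iff]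
  exact ⟨abs_clamp_le h0 _, (abs_clamp_le zero_le_one _).trans hR, abs_clamp_le h0 _⟩

lemma lipschitzWith_truncate (R : ℝ) : LipschitzWith 1 (truncate R) := by
  refine LipschitzWith.of_dist_le_mul fun z w => ?_
  have h : ∀ S s t : ℝ, dist (clamp S s) (clamp S t) ≤ dist s t := fun S s t => by
    simpa using (lipschitzWith_clamp S).dist_le_mul s t
  simp only [NNReal.coe_one, one_mul, Prod.dist_eq, truncate]
  exact max_le_max (h _ _ _) (max_le_max (h _ _ _) (h _ _ _))

/-- Trajectories of the truncated vector field. -/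
lemma exists_truncated_trajectory {V : ℝ → ℝ} (hV : ContDiff ℝ 3 V) {R : ℝ} (hR : 1 ≤ R)
    (z₀ : ℝ × ℝ × ℝ) {T : ℝ} (hT : T ≤ 0) :
    ∃ z : ℝ → ℝ × ℝ × ℝ, z 0 = z₀ ∧ ∀ τ ∈ Set.Icc T 0,
      HasDerivWithinAt z (chartField V (truncate R (z τ))) (Set.Icc T 0) τ := by
  obtain ⟨K, hK⟩ := exists_lipschitzOnWith_closedBall (contDiff_chartField hV) R
  obtain ⟨L, hL⟩ := (isCompact_closedBall (0 : ℝ × ℝ × ℝ) R).exists_bound_of_continuousOn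
    (contDiff_chartField hV).continuous.continuousOn
  have hL0 : 0 ≤ L := (norm_nonneg _).trans (hL _ (truncate_mem hR 0))
  have hlip : LipschitzWith K (fun z => chartField V (truncate R z)) := by
    have := hK.comp (s := Set.univ) (lipschitzWith_truncate R).lipschitzOnWith
      (fun z _ => truncate_mem hR z)
    rw [mul_one] at this
    exact lipschitzOnWith_univ.1 this
  -- The truncated field is bounded by `L` everywhere, so the radius `L * -T` serves for any length
  -- of time.
  have hpl : IsPicardLindelof (fun _ z => chartField V (truncate R z))
      (⟨0, hT, le_rfl⟩ : Set.Icc T 0) z₀ (⟨L * -T, by nlinarith⟩ : NNReal) 0 ⟨L, hL0⟩ K :=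
    { lipschitzOnWith := fun t _ => hlip.lipschitzOnWith
      continuousOn := fun x _ => continuousOn_const
      norm_le := fun t _ x _ => hL _ (truncate_mem hR x)
      mul_max_le := by
        have : max (0 - 0) (0 - T) = -T := by rw [max_eq_right] <;> linarith
        change L * max (0 - 0) (0 - T) ≤ L * -T - 0
        rw [this, sub_zero] }
  exact hpl.exists_eq_forall_mem_Icc_hasDerivWithinAt₀

lemma abs_sub_le_of_abs_deriv_le_one {f f' : ℝ → ℝ} {T : ℝ}
    (hf : ∀ τ ∈ Set.Icc T 0, HasDerivWithinAt f (f' τ) (Set.Icc T 0) τ)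
    (hb : ∀ τ ∈ Set.Icc T 0, |f' τ| ≤ 1) {τ : ℝ} (hτ : τ ∈ Set.Icc T 0) :
    |f τ - f 0| ≤ -T := by
  have := (convex_Icc T 0).norm_image_sub_le_of_norm_hasDerivWithin_le (C := 1) hf
    hb ⟨hτ.1.trans hτ.2, le_rfl⟩ hτ
  refine this.trans ?_
  rw [Real.norm_eq_abs, sub_zero, one_mul, abs_of_nonpos hτ.2]
  linarith [hτ.1]

lemma hasDerivWithinAt_constraint {V : ℝ → ℝ} (hV : ContDiff ℝ 3 V) {z : ℝ → ℝ × ℝ × ℝ}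
    {z' : ℝ × ℝ × ℝ} {I : Set ℝ} {τ : ℝ} (h : HasDerivWithinAt z z' I τ) :
    HasDerivWithinAt (fun s => constraint V (z s))
      (3 * (deriv V (z τ).2.2 * z'.2.2) * Real.exp (2 * (z τ).1)
        + 3 * V (z τ).2.2 * (Real.exp (2 * (z τ).1) * (2 * z'.1))
        + 2 * (z τ).2.1 * z'.2.1) I τ := by
  have hVd : HasDerivAt V (deriv V (z τ).2.2) (z τ).2.2 :=
    (hV.differentiable (by norm_num)).differentiableAt.hasDerivAt
  have h2 := hasDerivWithinAt_snd (hasDerivWithinAt_snd h)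
  have h1 := hasDerivWithinAt_fst (hasDerivWithinAt_snd h)
  have h0 := hasDerivWithinAt_fst h
  have := (((hVd.comp_hasDerivWithinAt τ h2).const_mul 3).mul (h0.const_mul 2).exp).add (h1.pow 2)
  exact this.congr_deriv (by simp)

/-- The left side is the rate of `constraint V - 1` along the truncated field, with `p` the
potential term; the bound feeds Grönwall's inequality. For `|y| ≤ 1` the rate is `2 y²` times the
defect `p + y² - 1`. For `|y| > 1` the defect is positive and dominates both `|y| - 1`, the size of
the clamping error, and `p`. -/
lemma abs_constraint_rate_le {p C B y : ℝ} (hp : 0 ≤ p) (hC : |C| ≤ B) :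
    |C * (clamp 1 y - y) + 2 * p * clamp 1 y ^ 2 - 2 * y * clamp 1 y * (1 - clamp 1 y ^ 2)|
      ≤ (B + 2) * |p + y ^ 2 - 1| := by
  have hB : 0 ≤ B := (abs_nonneg _).trans hC
  obtain ⟨hC1, hC2⟩ := abs_le.1 hC
  have hE := abs_nonneg (p + y ^ 2 - 1)
  rcases le_or_gt |y| 1 with hy | hy
  · rw [clamp_of_abs_le hy]
    have h : C * (y - y) + 2 * p * y ^ 2 - 2 * y * y * (1 - y ^ 2)
      = (2 * y ^ 2) * (p + y ^ 2 - 1) := by ring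
    have hy2 : y ^ 2 ≤ 1 := (sq_le_one_iff_abs_le_one y).2 hy
    rw [h, abs_mul, abs_of_nonneg (by positivity : 0 ≤ 2 * y ^ 2)]
    gcongr
    linarith
  · have key : ∀ d : ℝ, d ^ 2 = 1 → 1 ≤ y * d → clamp 1 y = d →
        |C * (clamp 1 y - y) + 2 * p * clamp 1 y ^ 2 - 2 * y * clamp 1 y * (1 - clamp 1 y ^ 2)|
          ≤ (B + 2) * |p + y ^ 2 - 1| := by
      intro d hd hyd hcl
      rw [hcl, hd]
      have e1 : y - d = (y * d - 1) * d := by linear_combination (-y) * hd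
      have e2 : y ^ 2 = (y * d) ^ 2 := by linear_combination (-y ^ 2) * hd
      have hd1 : |d| = 1 := by rw [← sq_eq_sq₀ (abs_nonneg d) zero_le_one, sq_abs, hd, one_pow]
      have e3 : |d - y| = y * d - 1 := by
        rw [abs_sub_comm, e1, abs_mul, hd1, mul_one, abs_of_nonneg (by linarith)]
      have e4 : |C * (d - y)| ≤ B * (y * d - 1) := by
        rw [abs_mul, e3]; gcongr
      have hpos : 0 ≤ p + y ^ 2 - 1 := by rw [e2]; nlinarith
      rw [abs_of_nonneg hpos]
      have e5 : y * d - 1 ≤ p + y ^ 2 - 1 := by rw [e2]; nlinarith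
      have e6 : B * (y * d - 1) ≤ B * (p + y ^ 2 - 1) := by gcongr
      have e7 : p ≤ p + y ^ 2 - 1 := by rw [e2]; nlinarith
      refine (le_of_eq ?_).trans ((abs_add_le (C * (d - y)) (2 * p)).trans ?_)
      · congr 1; ring
      · rw [abs_of_nonneg (by positivity : 0 ≤ 2 * p)]
        linarith
    rcases lt_abs.1 hy with h | h
    · exact key 1 (by norm_num) (by linarith) (by
        rw [clamp, min_eq_left h.le, max_eq_right]; norm_num)
    · exact key (-1) (by norm_num) (by linarith) (by
        rw [clamp, max_eq_left]; exact (min_le_right _ _).trans (by linarith))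

lemma abs_y_le_one {V : ℝ → ℝ} (hV0 : ∀ s, 0 ≤ V s) {z : ℝ × ℝ × ℝ} (h : constraint V z = 1) :
    |z.2.1| ≤ 1 := by
  rw [← sq_le_one_iff_abs_le_one]
  have : 0 ≤ 3 * V z.2.2 * Real.exp (2 * z.1) := by have := hV0 z.2.2; positivity
  rw [constraint] at h
  linarith

/-- A solution of the truncated system keeps the constraint by Grönwall, hence has `|y| ≤ 1`, so the
truncation never acts on it. -/
lemma exists_trajectory_Icc {V : ℝ → ℝ} (hV : ContDiff ℝ 3 V) (hV0 : ∀ s, 0 ≤ V s)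
    {z₀ : ℝ × ℝ × ℝ} (h₀ : constraint V z₀ = 1) {T : ℝ} (hT : T ≤ 0) :
    ∃ z : ℝ → ℝ × ℝ × ℝ, z 0 = z₀ ∧ IsTrajectoryOn V z (Set.Icc T 0) ∧
      ∀ τ ∈ Set.Icc T 0, constraint V (z τ) = 1 := by
  -- Under the truncated field `log x` and `φ` have speed at most 1, so over a time `-T` they cannot
  -- leave `[-R, R]`.
  set R := 1 + |z₀.1| + |z₀.2.2| - T with hRdef
  have hR : 1 ≤ R := by linarith [abs_nonneg z₀.1, abs_nonneg z₀.2.2]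
  obtain ⟨z, hz0, hz⟩ := exists_truncated_trajectory hV hR z₀ hT
  have hcl : ∀ y, |clamp 1 y| ≤ 1 := abs_clamp_le zero_le_one
  have hξ : ∀ τ ∈ Set.Icc T 0, clamp R (z τ).1 = (z τ).1 := by
    intro τ hτ
    have := abs_sub_le_of_abs_deriv_le_one (fun τ hτ => hasDerivWithinAt_fst (hz τ hτ))
      (fun τ _ => by
        simp only [chartField, truncate, abs_pow]
        exact pow_le_one₀ (abs_nonneg _) (hcl _)) hτ
    rw [hz0] at this
    apply clamp_of_abs_le
    have h3 := abs_sub_abs_le_abs_sub (z τ).1 z₀.1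
    linarith [abs_nonneg z₀.2.2]
  have hφ : ∀ τ ∈ Set.Icc T 0, clamp R (z τ).2.2 = (z τ).2.2 := by
    intro τ hτ
    have := abs_sub_le_of_abs_deriv_le_one
      (fun τ hτ => hasDerivWithinAt_snd (hasDerivWithinAt_snd (hz τ hτ)))
      (fun τ _ => by
        simp only [chartField, truncate, abs_mul, abs_of_pos sqrt_two_thirds_pos]
        exact mul_le_one₀ sqrt_two_thirds_le_one (abs_nonneg _) (hcl _)) hτ
    rw [hz0] at this
    apply clamp_of_abs_le
    have h3 := abs_sub_abs_le_abs_sub (z τ).2.2 z₀.2.2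
    linarith [abs_nonneg z₀.1]
  have hcont : ContinuousOn z (Set.Icc T 0) := fun τ hτ => (hz τ hτ).continuousWithinAt
  have hV' : Continuous (deriv V) := hV.continuous_deriv (by norm_num)
  obtain ⟨B, hB⟩ := isCompact_Icc.exists_bound_of_continuousOn
    (f := fun τ => 3 * √(2 / 3) * deriv V (z τ).2.2 * Real.exp (2 * (z τ).1))
    (s := Set.Icc T 0) (by fun_prop)
  have hE : ∀ τ ∈ Set.Icc T 0, constraint V (z τ) - 1 = 0 := by
    -- Time is reversed because the Grönwall argument runs to the right of the initial time.
    set E : ℝ → ℝ := fun s => constraint V (z (-s)) - 1 with hEdef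
    set D : ℝ → ℝ := fun s =>
      3 * (deriv V (z s).2.2 * (chartField V (truncate R (z s))).2.2) * Real.exp (2 * (z s).1)
        + 3 * V (z s).2.2 * (Real.exp (2 * (z s).1) * (2 * (chartField V (truncate R (z s))).1))
        + 2 * (z s).2.1 * (chartField V (truncate R (z s))).2.1 with hD
    have hneg : ∀ s ∈ Set.Icc 0 (-T), -s ∈ Set.Icc T 0 := fun s hs =>
      ⟨by linarith [hs.2], by linarith [hs.1]⟩
    have hder : ∀ s ∈ Set.Icc 0 (-T), HasDerivWithinAt E (-D (-s)) (Set.Icc 0 (-T)) s := by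
      intro s hs
      have h1 := (hasDerivWithinAt_constraint hV (hz (-s) (hneg s hs))).sub_const 1
      have h2 := h1.scomp s (hasDerivAt_neg s).hasDerivWithinAt hneg
      exact h2.congr_deriv (by rw [neg_one_smul])
    have hzero := eq_zero_of_abs_deriv_le_mul_abs_self_of_eq_zero_right (f := E)
      (f' := fun s => -D (-s)) (K := B + 2) (a := 0) (b := -T)
      (fun s hs => (hder s hs).continuousWithinAt)
      (fun s hs => (hder s ⟨hs.1, hs.2.le⟩).mono_of_mem_nhdsWithin
        (mem_of_superset (Icc_mem_nhdsGE hs.2) (Set.Icc_subset_Icc_left hs.1)))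
      (by simp [hEdef, hz0, h₀]) (by
        intro s hs
        have hs' := hneg s ⟨hs.1, hs.2.le⟩
        rw [norm_neg, Real.norm_eq_abs, Real.norm_eq_abs]
        have hp : 0 ≤ 3 * V (z (-s)).2.2 * Real.exp (2 * (z (-s)).1) := by
          have := hV0 (z (-s)).2.2; positivity
        refine (le_of_eq ?_).trans (abs_constraint_rate_le (y := (z (-s)).2.1) hp (hB _ hs'))
        congr 1
        simp only [hD, chartField, truncate, hξ _ hs', hφ _ hs', sqrt_three_halves_eq]
        ring)
    intro τ hτ
    have := hzero (-τ) ⟨by linarith [hτ.2], by linarith [hτ.1]⟩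
    simpa [hEdef] using this
  have hc : ∀ τ ∈ Set.Icc T 0, constraint V (z τ) = 1 := fun τ hτ => by linarith [hE τ hτ]
  refine ⟨z, hz0, fun τ hτ => ?_, hc⟩
  have := hz τ hτ
  rwa [truncate, hξ τ hτ, hφ τ hτ, clamp_of_abs_le (abs_y_le_one hV0 (hc τ hτ))] at this

/-- Trajectories on the phase space exist for all past times. -/
lemma exists_trajectory_Iic {V : ℝ → ℝ} (hV : ContDiff ℝ 3 V) (hV0 : ∀ s, 0 ≤ V s)
    {z₀ : ℝ × ℝ × ℝ} (h₀ : constraint V z₀ = 1) :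
    ∃ z : ℝ → ℝ × ℝ × ℝ, z 0 = z₀ ∧ IsTrajectoryOn V z (Set.Iic 0) ∧
      ∀ τ ≤ 0, constraint V (z τ) = 1 := by
  choose w hw0 hw hwc using fun n : ℕ =>
    exists_trajectory_Icc hV hV0 h₀ (T := -(n : ℝ)) (by simp)
  have hmono : ∀ m n : ℕ, m ≤ n → Set.EqOn (w m) (w n) (Set.Icc (-(m : ℝ)) 0) := by
    intro m n hmn
    refine (hw m).eqOn hV ((hw n).mono (Set.Icc_subset_Icc_left ?_)) (by rw [hw0, hw0])
    simpa using hmn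
  have heq : ∀ n : ℕ, ∀ τ ∈ Set.Icc (-(n : ℝ)) 0, w ⌈-τ⌉₊ τ = w n τ := by
    intro n τ hτ
    exact hmono _ _ (Nat.ceil_le.2 (by linarith [hτ.1])) ⟨by linarith [Nat.le_ceil (-τ)], hτ.2⟩
  refine ⟨fun τ => w ⌈-τ⌉₊ τ, by simp [hw0], fun τ hτ => ?_, fun τ hτ => ?_⟩
  · have hτ' : τ ≤ 0 := hτ
    obtain ⟨n, hn⟩ := exists_nat_gt (-τ)
    have hmem : τ ∈ Set.Icc (-(n : ℝ)) 0 := ⟨by linarith, hτ⟩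
    have h1 : HasDerivWithinAt (w n) (chartField V (w n τ)) (Set.Iic 0) τ :=
      (hw n τ hmem).mono_of_mem_nhdsWithin (by
        filter_upwards [self_mem_nhdsWithin, mem_nhdsWithin_of_mem_nhds
          (Ici_mem_nhds (by linarith : -(n : ℝ) < τ))] with s hs1 hs2 using ⟨hs2, hs1⟩)
    rw [← heq n τ hmem] at h1
    refine h1.congr_of_eventuallyEq ?_ (heq n τ hmem)
    filter_upwards [self_mem_nhdsWithin, mem_nhdsWithin_of_mem_nhds
      (Ici_mem_nhds (by linarith : -(n : ℝ) < τ))] with s hs1 hs2 using heq n s ⟨hs2, hs1⟩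
  · exact hwc _ τ ⟨by linarith [Nat.le_ceil (-τ)], hτ⟩

/-! ### Derivatives of convergent functions -/

/-- Mean value theorem on `[τ, τ + h]`, where the increment of a convergent function is eventually
less than `h * ε`. -/
lemma eventually_exists_abs_deriv_lt {f g : ℝ → ℝ} {l : ℝ}
    (hf : ∀ τ < 0, HasDerivAt f (g τ) τ) (hl : Tendsto f atBot (𝓝 l)) {h ε : ℝ} (hh : 0 < h)
    (hε : 0 < ε) : ∀ᶠ τ in atBot, ∃ c ∈ Set.Ioo τ (τ + h), |g c| < ε := by
  obtain ⟨T, hT⟩ := eventually_atBot.1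
    (hl.eventually (Metric.ball_mem_nhds l (by positivity : 0 < h * ε / 2)))
  filter_upwards [eventually_le_atBot (T - h), eventually_lt_atBot (-h)] with τ h1 h2
  obtain ⟨c, hc, hc'⟩ := exists_hasDerivAt_eq_slope f g (by linarith : τ < τ + h)
    (fun x hx => (hf x (by linarith [hx.2])).continuousAt.continuousWithinAt)
    (fun x hx => hf x (by linarith [hx.2]))
  refine ⟨c, hc, ?_⟩
  have e1 := hT τ (by linarith)
  have e2 := hT (τ + h) (by linarith)
  rw [Real.dist_eq] at e1 e2
  rw [hc', add_sub_cancel_left, abs_div, abs_of_pos hh, div_lt_iff₀ hh]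
  calc |f (τ + h) - f τ| = |(f (τ + h) - l) - (f τ - l)| := by congr 1; ring
    _ ≤ |f (τ + h) - l| + |f τ - l| := abs_sub _ _
    _ < ε * h := by linarith

/-- Barbalat's lemma. -/
lemma tendsto_deriv_zero {f g g' : ℝ → ℝ} {l B : ℝ} (hf : ∀ τ < 0, HasDerivAt f (g τ) τ)
    (hg : ∀ τ < 0, HasDerivAt g (g' τ) τ) (hB : ∀ τ < 0, |g' τ| ≤ B)
    (hl : Tendsto f atBot (𝓝 l)) : Tendsto g atBot (𝓝 0) := by
  have hB0 : 0 ≤ B := (abs_nonneg _).trans (hB (-1) (by norm_num))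
  rw [Metric.tendsto_nhds]
  intro ε hε
  have hh : 0 < ε / (2 * (B + 1)) := by positivity
  filter_upwards [eventually_exists_abs_deriv_lt hf hl hh (half_pos hε),
    eventually_lt_atBot (-(ε / (2 * (B + 1))))] with τ h1 h2
  obtain ⟨c, hc, hgc⟩ := h1
  obtain ⟨d, hd, hd'⟩ := exists_hasDerivAt_eq_slope g g' hc.1
    (fun x hx => (hg x (by linarith [hx.2, hc.2])).continuousAt.continuousWithinAt)
    (fun x hx => hg x (by linarith [hx.2, hc.2]))
  have h3 := hB d (by linarith [hd.2, hc.2])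
  have hcτ : 0 < c - τ := sub_pos.2 hc.1
  rw [hd', abs_div, abs_of_pos hcτ, div_le_iff₀ hcτ] at h3
  have h4 : B * (c - τ) ≤ ε / 2 := by
    have h5 : c - τ ≤ ε / (2 * (B + 1)) := by linarith [hc.2]
    calc B * (c - τ) ≤ (B + 1) * (ε / (2 * (B + 1))) := by gcongr; linarith
      _ = ε / 2 := by field_simp
  rw [Real.dist_eq, sub_zero]
  calc |g τ| = |g c - (g c - g τ)| := by congr 1; ring
    _ ≤ |g c| + |g c - g τ| := abs_sub _ _
    _ < ε := by linarith

lemma tendsto_deriv_eq_zero {f g : ℝ → ℝ} {l L : ℝ} (hf : ∀ τ < 0, HasDerivAt f (g τ) τ)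
    (hl : Tendsto f atBot (𝓝 l)) (hL : Tendsto g atBot (𝓝 L)) : L = 0 := by
  by_contra hne
  have hpos : 0 < |L| := abs_pos.2 hne
  obtain ⟨T, hT⟩ := eventually_atBot.1
    (hL.abs.eventually (lt_mem_nhds (half_lt_self hpos)))
  obtain ⟨τ, ⟨c, hc, hgc⟩, hτ⟩ := ((eventually_exists_abs_deriv_lt hf hl zero_lt_one
    (half_pos hpos)).and (eventually_le_atBot (T - 1))).exists
  linarith [hT c (by linarith [hc.2])]

/-! ### Convergence of orbits with bounded scalar field -/

section PastLimit

variable {V : ℝ → ℝ} {z : ℝ → ℝ × ℝ × ℝ} {M : ℝ}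

lemma IsTrajectoryOn.hasDerivAt_fst (hz : IsTrajectoryOn V z (Set.Iic 0)) {τ : ℝ} (hτ : τ < 0) :
    HasDerivAt (fun s => (z s).1) ((z τ).2.1 ^ 2) τ :=
  (hasDerivWithinAt_fst (hz τ hτ.le)).hasDerivAt (Iic_mem_nhds hτ)

lemma IsTrajectoryOn.hasDerivAt_y (hz : IsTrajectoryOn V z (Set.Iic 0)) {τ : ℝ} (hτ : τ < 0) :
    HasDerivAt (fun s => (z s).2.1) ((chartField V (z τ)).2.1) τ :=
  (hasDerivWithinAt_fst (hasDerivWithinAt_snd (hz τ hτ.le))).hasDerivAt (Iic_mem_nhds hτ)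

lemma IsTrajectoryOn.hasDerivAt_field (hz : IsTrajectoryOn V z (Set.Iic 0)) {τ : ℝ}
    (hτ : τ < 0) : HasDerivAt (fun s => (z s).2.2) (√(2 / 3) * (z τ).2.1) τ :=
  (hasDerivWithinAt_snd (hasDerivWithinAt_snd (hz τ hτ.le))).hasDerivAt (Iic_mem_nhds hτ)

lemma IsTrajectoryOn.monotoneOn_fst (hz : IsTrajectoryOn V z (Set.Iic 0)) :
    MonotoneOn (fun s => (z s).1) (Set.Iic 0) := by
  refine monotoneOn_of_hasDerivWithinAt_nonneg (f' := fun τ => (z τ).2.1 ^ 2) (convex_Iic 0)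
    hz.continuousOn.fst (fun τ hτ => ?_) (fun τ _ => sq_nonneg _)
  rw [interior_Iic] at hτ
  exact (hz.hasDerivAt_fst hτ).hasDerivWithinAt

/-- If the scalar field is bounded to the past then `x` is bounded away from zero. -/
lemma IsTrajectoryOn.exists_tendsto_fst (hV : ContDiff ℝ 3 V)
    (hz : IsTrajectoryOn V z (Set.Iic 0)) (hc : ∀ τ ≤ 0, constraint V (z τ) = 1)
    (hM : ∀ τ ≤ 0, |(z τ).2.2| ≤ M) : ∃ l, Tendsto (fun s => (z s).1) atBot (𝓝 l) := by
  -- Reversing time and freezing the function for `s < 0` makes it monotone on the whole line, where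
  -- the dichotomy for monotone functions applies.
  have hanti : Antitone (fun s => (z (min (-s) 0)).1) := fun s t hst =>
    hz.monotoneOn_fst (Set.mem_Iic.2 (min_le_right _ _)) (Set.mem_Iic.2 (min_le_right _ _))
      (by gcongr)
  have hcongr : (fun s => (z (min (-(-s)) 0)).1) =ᶠ[atBot] fun s => (z s).1 := by
    filter_upwards [eventually_le_atBot 0] with s hs
    rw [neg_neg, min_eq_left hs]
  rcases tendsto_atTop_of_antitone hanti with h | ⟨l, hl⟩
  swap
  · exact ⟨l, (hl.comp tendsto_neg_atBot_atTop).congr' hcongr⟩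
  exfalso
  have hξ : Tendsto (fun s => (z s).1) atBot atBot :=
    (h.comp tendsto_neg_atBot_atTop).congr' hcongr
  obtain ⟨B, hB⟩ := isCompact_Icc.exists_bound_of_continuousOn
    (s := Set.Icc (-M) M) hV.continuous.continuousOn
  have hexp : Tendsto (fun s => 3 * B * Real.exp (2 * (z s).1)) atBot (𝓝 (3 * B * 0)) :=
    (Real.tendsto_exp_atBot.comp (hξ.const_mul_atBot two_pos)).const_mul _
  rw [mul_zero] at hexp
  obtain ⟨T, hT⟩ := eventually_atBot.1
    (hexp.eventually (gt_mem_nhds (by norm_num : (0 : ℝ) < 3 / 4)))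
  have hy : ∀ τ ≤ min T 0, 1 / 4 ≤ (z τ).2.1 ^ 2 := by
    intro τ hτ
    have h0 := hτ.trans (min_le_right _ _)
    have h1 := hT τ (hτ.trans (min_le_left _ _))
    have h2 := hB (z τ).2.2 (abs_le.1 (hM τ h0))
    have h3 := hc τ h0
    rw [constraint] at h3
    have h4 : 3 * V (z τ).2.2 * Real.exp (2 * (z τ).1) ≤ 3 * B * Real.exp (2 * (z τ).1) := by
      gcongr
      exact (le_abs_self _).trans h2
    linarith
  have hM0 : 0 ≤ M := (abs_nonneg _).trans (hM 0 le_rfl)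
  set T' := min T 0 - 1 with hT'
  have hT0 : T' < 0 := by linarith [min_le_right T 0]
  -- With `y² ≥ 1/4` the speed of `φ` is at least `1/3`, so over a time `8 * M + 1` it moves by more
  -- than `2 * M`.
  obtain ⟨c, hc1, hc2⟩ := exists_hasDerivAt_eq_slope (fun s => (z s).2.2)
    (fun s => √(2 / 3) * (z s).2.1) (by linarith : T' - (8 * M + 1) < T')
    (fun x hx => (hz.hasDerivAt_field (by linarith [hx.2])).continuousAt.continuousWithinAt)
    (fun x hx => hz.hasDerivAt_field (by linarith [hx.2]))
  have h1 := hy c (by linarith [hc1.2])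
  have h2 : (√(2 / 3) * (z c).2.1) ^ 2 ≥ (1 / 3) ^ 2 := by
    rw [mul_pow, sqrt_two_thirds_sq]; linarith
  have h3 : 1 / 3 ≤ |√(2 / 3) * (z c).2.1| := by
    rw [← abs_of_pos (by norm_num : (0 : ℝ) < 1 / 3)]
    exact sq_le_sq.1 h2
  rw [hc2, sub_sub_cancel, abs_div, abs_of_pos (by linarith : (0 : ℝ) < 8 * M + 1),
    le_div_iff₀ (by linarith)] at h3
  have h4 := abs_sub (z T').2.2 (z (T' - (8 * M + 1))).2.2
  have h5 := hM T' hT0.le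
  have h6 := hM (T' - (8 * M + 1)) (by linarith)
  linarith

lemma IsTrajectoryOn.exists_norm_le_past (hV : ContDiff ℝ 3 V) (hV0 : ∀ s, 0 ≤ V s)
    (hz : IsTrajectoryOn V z (Set.Iic 0)) (hc : ∀ τ ≤ 0, constraint V (z τ) = 1)
    (hM : ∀ τ ≤ 0, |(z τ).2.2| ≤ M) : ∃ R, ∀ τ ≤ 0, z τ ∈ Metric.closedBall 0 R := by
  obtain ⟨l, hl⟩ := hz.exists_tendsto_fst hV hc hM
  have hge : ∀ τ ≤ 0, l ≤ (z τ).1 := fun τ hτ =>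
    le_of_tendsto hl (by
      filter_upwards [eventually_le_atBot τ] with s hs
        using hz.monotoneOn_fst (hs.trans hτ) hτ hs)
  refine ⟨max (max |l| |(z 0).1|) (max 1 M), fun τ hτ => ?_⟩
  rw [mem_closedBall_zero_iff, Prod.norm_def, Prod.norm_def]
  refine max_le_max ?_ (max_le_max (abs_y_le_one hV0 (hc τ hτ)) (hM τ hτ))
  exact abs_le_max_abs_abs (hge τ hτ) (hz.monotoneOn_fst hτ (Set.mem_Iic.2 le_rfl) hτ)

/-- If the scalar field is bounded to the past then the trajectory converges to an equilibrium. -/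
lemma IsTrajectoryOn.exists_tendsto (hV : ContDiff ℝ 3 V) (hV0 : ∀ s, 0 ≤ V s)
    (hz : IsTrajectoryOn V z (Set.Iic 0)) (hc : ∀ τ ≤ 0, constraint V (z τ) = 1)
    (hM : ∀ τ ≤ 0, |(z τ).2.2| ≤ M) :
    ∃ l c, Tendsto z atBot (𝓝 (l, 0, c)) ∧ constraint V (l, 0, c) = 1 ∧ deriv V c = 0 := by
  obtain ⟨l, hl⟩ := hz.exists_tendsto_fst hV hc hM
  obtain ⟨R, hR⟩ := hz.exists_norm_le_past hV hV0 hc hM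
  have hV' : Continuous (deriv V) := hV.continuous_deriv (by norm_num)
  have hge : ∀ τ ≤ 0, l ≤ (z τ).1 := fun τ hτ =>
    le_of_tendsto hl (by
      filter_upwards [eventually_le_atBot τ] with s hs
        using hz.monotoneOn_fst (hs.trans hτ) hτ hs)
  obtain ⟨B, hB⟩ := (isCompact_closedBall (0 : ℝ × ℝ × ℝ) R).exists_bound_of_continuousOn
    (f := fun z => 2 * z.2.1 * (chartField V z).2.1) (by
      have := (contDiff_chartField hV).continuous
      fun_prop)
  -- Barbalat's lemma for `log x`, whose derivative is `y²`.
  have hy2 : Tendsto (fun s => (z s).2.1 ^ 2) atBot (𝓝 0) :=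
    tendsto_deriv_zero (fun τ hτ => hz.hasDerivAt_fst hτ)
      (fun τ hτ => (hz.hasDerivAt_y hτ).pow 2)
      (fun τ hτ => by simpa using hB (z τ) (hR τ hτ.le)) hl
  have hy : Tendsto (fun s => (z s).2.1) atBot (𝓝 0) := by
    rw [tendsto_zero_iff_abs_tendsto_zero]
    simpa [Function.comp_def, Real.sqrt_sq_eq_abs] using hy2.sqrt
  have hVeq : ∀ τ ≤ 0, V (z τ).2.2 = (1 - (z τ).2.1 ^ 2) * Real.exp (-(2 * (z τ).1)) / 3 := by
    intro τ hτ
    have h1 := hc τ hτ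
    rw [constraint] at h1
    have h2 : Real.exp (2 * (z τ).1) * Real.exp (-(2 * (z τ).1)) = 1 := by
      rw [← Real.exp_add]; simp
    linear_combination (Real.exp (-(2 * (z τ).1)) / 3) * h1 - V (z τ).2.2 * h2
  set v := Real.exp (-(2 * l)) / 3 with hv
  have hVlim : Tendsto (fun s => V (z s).2.2) atBot (𝓝 v) := by
    have h1 : Tendsto (fun τ => (1 - (z τ).2.1 ^ 2) * Real.exp (-(2 * (z τ).1)) / 3) atBot
        (𝓝 ((1 - 0) * Real.exp (-(2 * l)) / 3)) :=
      ((hy2.const_sub 1).mul ((hl.const_mul 2).neg.rexp)).div_const 3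
    rw [sub_zero, one_mul] at h1
    refine h1.congr' ?_
    filter_upwards [eventually_le_atBot 0] with τ hτ using (hVeq τ hτ).symm
  have hφ : ∃ c, Tendsto (fun s => (z s).2.2) atBot (𝓝 c) := by
    refine tendsto_of_no_upcrossings dense_univ ?_
      ⟨M, eventually_map.2 ?_⟩ ⟨-M, eventually_map.2 ?_⟩
    · rintro a - b - hab ⟨ha, hb⟩
      -- Oscillation across `(a, b)` makes `φ` take each intermediate value arbitrarily far in the
      -- past, so `V` equals its limit `v` there.
      have hhit : ∀ c ∈ Set.Ioo a b, ∀ T ≤ 0, ∃ τ ≤ T, (z τ).2.2 = c := by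
        intro c hc T hT
        obtain ⟨s, hs, hsT⟩ := (ha.and_eventually (eventually_le_atBot T)).exists
        obtain ⟨t, ht, htT⟩ := (hb.and_eventually (eventually_le_atBot T)).exists
        have hcont : ContinuousOn (fun s => (z s).2.2) (Set.Iic T) :=
          hz.continuousOn.snd.snd.mono (Set.Iic_subset_Iic.2 hT)
        exact isPreconnected_Iic.intermediate_value hsT htT hcont
          ⟨(hs.trans hc.1).le, (hc.2.trans ht).le⟩
      have hconst : ∀ c ∈ Set.Ioo a b, V c = v := by
        intro c hc
        by_contra hne
        obtain ⟨T, hT⟩ := eventually_atBot.1 (hVlim.eventually_ne (Ne.symm hne))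
        obtain ⟨τ, hτ, hτc⟩ := hhit c hc (min T 0) (min_le_right _ _)
        exact hT τ (hτ.trans (min_le_left _ _)) (by rw [hτc])
      have hm : (a + b) / 2 ∈ Set.Ioo a b := ⟨by linarith, by linarith⟩
      have hderiv : deriv V ((a + b) / 2) = 0 := by
        have : V =ᶠ[𝓝 ((a + b) / 2)] fun _ => v := by
          filter_upwards [Ioo_mem_nhds hm.1 hm.2] with c hc using hconst c hc
        rw [this.deriv_eq, deriv_const]
      obtain ⟨τ, hτ, hτm⟩ := hhit _ hm 0 le_rfl
      -- As `log x ≥ l`, the potential term `3 v x²` is already at least 1, which leaves nothing for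
      -- `y²`.
      have hy0 : (z τ).2.1 = 0 := by
        have h1 := hc τ hτ
        rw [constraint, hτm, hconst _ hm, hv] at h1
        have h2 : 1 ≤ Real.exp (-(2 * l)) * Real.exp (2 * (z τ).1) := by
          rw [← Real.exp_add, Real.one_le_exp_iff]; linarith [hge τ hτ]
        have h3 : (z τ).2.1 ^ 2 ≤ 0 := by nlinarith
        exact pow_eq_zero_iff two_ne_zero |>.1 (le_antisymm h3 (sq_nonneg _))
      have hstat : chartField V (z τ) = 0 := by
        simp [chartField, hy0, hτm, hderiv]
      obtain ⟨s, hs, hsτ⟩ := (ha.and_eventually (eventually_le_atBot τ)).exists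
      have hEq := (hz.mono (Set.Icc_subset_Iic_self.trans (Set.Iic_subset_Iic.2 hτ))).eqOn
        (a := s) hV (w := fun _ => z τ)
        (fun t _ => by rw [hstat]; exact hasDerivWithinAt_const _ _ _) rfl
      have h4 : z s = z τ := hEq ⟨le_rfl, hsτ⟩
      rw [h4, hτm] at hs
      linarith
    · filter_upwards [eventually_le_atBot 0] with τ hτ using (abs_le.1 (hM τ hτ)).2
    · filter_upwards [eventually_le_atBot 0] with τ hτ using (abs_le.1 (hM τ hτ)).1
  obtain ⟨c, hφc⟩ := hφ
  have hlim : Tendsto z atBot (𝓝 (l, 0, c)) := hl.prodMk_nhds (hy.prodMk_nhds hφc)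
  refine ⟨l, c, hlim, ?_, ?_⟩
  · have hcc : Continuous (constraint V) := by
      have := hV.continuous
      unfold constraint
      fun_prop
    refine tendsto_nhds_unique ((hcc.tendsto _).comp hlim) (tendsto_const_nhds.congr' ?_)
    filter_upwards [eventually_le_atBot 0] with τ hτ using (hc τ hτ).symm
  · have hcont : Continuous (fun z => (chartField V z).2.1) :=
      (contDiff_chartField hV).continuous.snd.fst
    have h0 := tendsto_deriv_eq_zero (fun τ hτ => hz.hasDerivAt_y hτ) hy
      ((hcont.tendsto _).comp hlim)
    simpa [chartField, sqrt_three_halves_pos.ne', Real.exp_ne_zero] using h0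

end PastLimit

/-! ### The cone estimate -/

/-- Coefficients of a quadratic form that decays along the linear flow `v' = u`,
`u' = -u - k v`. -/
lemma exists_cone_coefficients (k : ℝ) : ∃ b μ : ℝ, |b| ≤ 1 ∧ 0 < μ ∧ 0 < 1 - b - μ ∧
    0 < b * k - μ * (k + b * (1 - 2 * μ)) := by
  rcases le_or_gt k 0 with hk | hk
  · exact ⟨-1, 1 / 4, by norm_num, by norm_num, by norm_num, by linarith⟩
  · have h1 : min (k / 2) (1 / 4) ≤ k / 2 := min_le_left _ _
    have h2 : min (k / 2) (1 / 4) ≤ 1 / 4 := min_le_right _ _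
    refine ⟨1 / 2, min (k / 2) (1 / 4), ?_, lt_min (half_pos hk) (by norm_num), by linarith, ?_⟩
    · rw [abs_of_pos] <;> norm_num
    · set μ := min (k / 2) (1 / 4)
      have h3 : 0 < (1 / 2 - μ) * (k - μ) := mul_pos (by linarith) (by linarith)
      nlinarith

lemma abs_le_of_quadratic_form_nonpos {u v b c : ℝ} (h : u ^ 2 + 2 * b * u * v + c * v ^ 2 ≤ 0) :
    |u| ≤ (1 + 2 * |b| + |c|) * |v| := by
  by_contra! hlt
  have hv := abs_nonneg v
  have hb := abs_nonneg b
  have hc := abs_nonneg c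
  have hvu : |v| ≤ |u| := by nlinarith
  have h1 : -(2 * b * u * v) ≤ 2 * |b| * |u| * |v| := by
    refine (neg_le_abs _).trans (le_of_eq ?_)
    simp [abs_mul]
  have h2 : -(c * v ^ 2) ≤ |c| * (|u| * |v|) := by
    calc -(c * v ^ 2) ≤ |c| * (|v| * |v|) := by
          refine (neg_le_abs _).trans (le_of_eq ?_)
          rw [abs_mul, abs_pow, sq]
      _ ≤ |c| * (|u| * |v|) := by gcongr
  have hu : 0 < |u| := lt_of_le_of_lt (by positivity) hlt
  have h3 : |u| * ((1 + 2 * |b| + |c|) * |v|) < |u| * |u| := by gcongr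
  have h4 : |u| * |u| = u ^ 2 := by rw [abs_mul_abs_self, sq]
  nlinarith [mul_nonneg hu.le hv]

/-- Bounded past trajectories of small Lipschitz perturbations of the linear system `v' = u`,
`u' = -u - k v` lie in a cone around the axis `u = 0`. -/
lemma exists_cone_bound (k : ℝ) : ∃ ε > 0, ∃ L : ℝ, ∀ (T B : ℝ) (u v u' : ℝ → ℝ),
    ContinuousOn u (Set.Iic T) → ContinuousOn v (Set.Iic T) →
    (∀ τ < T, HasDerivAt u (u' τ) τ) → (∀ τ < T, HasDerivAt v (u τ) τ) →
    (∀ τ < T, |u' τ + u τ + k * v τ| ≤ ε * (|u τ| + |v τ|)) →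
    (∀ τ ≤ T, |u τ| ≤ B) → (∀ τ ≤ T, |v τ| ≤ B) → |u T| ≤ L * |v T| := by
  obtain ⟨b, μ, hb, hμ, hα, hβ⟩ := exists_cone_coefficients k
  set c := k + b * (1 - 2 * μ) with hc
  set α := 1 - b - μ with hαdef
  set β := b * k - μ * c with hβdef
  -- Since `|b| ≤ 1`, a perturbation of this size contributes at most `2 * min α β * (u² + v²)` to
  -- the derivative of the form, which the negative terms absorb.
  refine ⟨min α β / 2, by positivity, 1 + 2 * |b| + |c|, ?_⟩
  intro T B u v u' hu hv hu' hv' herr huB hvB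
  -- The weight forces `Q → 0` in the past for bounded `u`, `v`. As `Q` is nonincreasing, `Q T ≤ 0`,
  -- which is the cone condition.
  set Q : ℝ → ℝ := fun τ =>
    (u τ ^ 2 + 2 * b * (u τ * v τ) + c * v τ ^ 2) * Real.exp (2 * μ * τ) with hQ
  have hcont : ContinuousOn Q (Set.Iic T) := by fun_prop
  have hanti : AntitoneOn Q (Set.Iic T) := by
    refine antitoneOn_of_hasDerivWithinAt_nonpos (convex_Iic T) hcont
      (f' := fun τ => ((2 * u τ * u' τ + 2 * b * (u' τ * v τ + u τ * u τ) + c * (2 * v τ * u τ))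
        + 2 * μ * (u τ ^ 2 + 2 * b * (u τ * v τ) + c * v τ ^ 2)) * Real.exp (2 * μ * τ))
      (fun τ hτ => ?_) (fun τ hτ => ?_)
    · rw [interior_Iic] at hτ
      have h1 := hu' τ hτ
      have h2 := hv' τ hτ
      have h3 := (((h1.pow 2).add ((h1.mul h2).const_mul (2 * b))).add
        ((h2.pow 2).const_mul c)).mul ((hasDerivAt_id τ).const_mul (2 * μ)).exp
      refine (h3.congr_deriv ?_).hasDerivWithinAt
      simp
      ring
    · rw [interior_Iic] at hτ
      have h1 := herr τ hτ
      set e := u' τ + u τ + k * v τ with he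
      have h2 : u' τ = e - u τ - k * v τ := by rw [he]; ring
      -- The value of `c` is the one that cancels the `u v` terms.
      have h3 : (2 * u τ * u' τ + 2 * b * (u' τ * v τ + u τ * u τ) + c * (2 * v τ * u τ))
          + 2 * μ * (u τ ^ 2 + 2 * b * (u τ * v τ) + c * v τ ^ 2)
          = -2 * α * u τ ^ 2 - 2 * β * v τ ^ 2 + 2 * ((u τ + b * v τ) * e) := by
        rw [h2, hβdef, hαdef, hc]; ring
      have h4 : (u τ + b * v τ) * e ≤ (|u τ| + |v τ|) * (min α β / 2 * (|u τ| + |v τ|)) := by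
        refine (le_abs_self _).trans ?_
        rw [abs_mul]
        have h5 : |u τ + b * v τ| ≤ |u τ| + |v τ| := by
          refine (abs_add_le _ _).trans ?_
          rw [abs_mul]
          have := mul_le_of_le_one_left (abs_nonneg (v τ)) hb
          linarith
        gcongr
      have h6 : (|u τ| + |v τ|) ^ 2 ≤ 2 * (u τ ^ 2 + v τ ^ 2) := by
        rw [← sq_abs (u τ), ← sq_abs (v τ)]
        nlinarith [sq_nonneg (|u τ| - |v τ|)]
      have h7 : 0 < min α β := lt_min hα hβ
      have h8 : min α β * (|u τ| + |v τ|) ^ 2 ≤ min α β * (2 * (u τ ^ 2 + v τ ^ 2)) := by gcongr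
      have h9 : min α β * u τ ^ 2 ≤ α * u τ ^ 2 := by gcongr; exact min_le_left _ _
      have h10 : min α β * v τ ^ 2 ≤ β * v τ ^ 2 := by gcongr; exact min_le_right _ _
      refine mul_nonpos_of_nonpos_of_nonneg ?_ (Real.exp_pos _).le
      rw [h3]
      nlinarith
  have hbound : ∀ τ ≤ T, |Q τ| ≤ (B * B + 2 * (B * B) + |c| * (B * B)) * Real.exp (2 * μ * τ) := by
    intro τ hτ
    have hu1 := huB τ hτ
    have hv1 := hvB τ hτ
    have hB : 0 ≤ B := (abs_nonneg _).trans hu1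
    rw [hQ, abs_mul, abs_of_pos (Real.exp_pos _)]
    gcongr
    refine (abs_add_three _ _ _).trans ?_
    rw [abs_mul, abs_mul, abs_mul, abs_mul, abs_pow, abs_pow, sq |u τ|, sq |v τ|, abs_two]
    have h1 : 2 * |b| * (|u τ| * |v τ|) ≤ 2 * 1 * (B * B) := by gcongr
    rw [mul_one] at h1
    refine add_le_add_three ?_ h1 ?_ <;> gcongr
  have hlim : Tendsto Q atBot (𝓝 0) := by
    have hexp : Tendsto (fun τ => (B * B + 2 * (B * B) + |c| * (B * B)) * Real.exp (2 * μ * τ))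
        atBot (𝓝 ((B * B + 2 * (B * B) + |c| * (B * B)) * 0)) :=
      (Real.tendsto_exp_atBot.comp
        (tendsto_id.const_mul_atBot (by positivity : 0 < 2 * μ))).const_mul _
    rw [mul_zero] at hexp
    refine squeeze_zero_norm' ?_ hexp
    filter_upwards [eventually_le_atBot T] with τ hτ using hbound τ hτ
  have hQT : Q T ≤ 0 := ge_of_tendsto hlim (by
    filter_upwards [eventually_le_atBot T] with τ hτ
      using hanti hτ (Set.mem_Iic.2 le_rfl) hτ)
  refine abs_le_of_quadratic_form_nonpos (le_of_mul_le_mul_right ?_ (Real.exp_pos (2 * μ * T)))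
  rw [zero_mul]
  refine le_trans (le_of_eq ?_) hQT
  simp only [hQ]
  ring

/-! ### The planar system near a de Sitter equilibrium -/

/-- The rate of change of `y` on the phase space, as a function of `(y, φ)`. -/
noncomputable def reducedRate (V : ℝ → ℝ) (q : ℝ × ℝ) : ℝ :=
  -((1 - q.1 ^ 2) * (q.1 + √(3 / 2) * deriv V q.2 / (3 * V q.2)))

/-- The coordinate `log x` on the phase space, as a function of `(y, φ)`. -/
noncomputable def reducedLogX (V : ℝ → ℝ) (q : ℝ × ℝ) : ℝ :=
  Real.log ((1 - q.1 ^ 2) / (3 * V q.2)) / 2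

lemma exp_of_constraint {V : ℝ → ℝ} {z : ℝ × ℝ × ℝ} (hc : constraint V z = 1)
    (hV : 0 < V z.2.2) : Real.exp (2 * z.1) = (1 - z.2.1 ^ 2) / (3 * V z.2.2) := by
  rw [constraint] at hc
  field_simp
  linarith

lemma chartField_eq_reducedRate {V : ℝ → ℝ} {z : ℝ × ℝ × ℝ} (hc : constraint V z = 1)
    (hV : 0 < V z.2.2) : (chartField V z).2.1 = reducedRate V z.2 := by
  rw [chartField, reducedRate, exp_of_constraint hc hV]
  ring

lemma fst_eq_reducedLogX {V : ℝ → ℝ} {z : ℝ × ℝ × ℝ} (hc : constraint V z = 1)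
    (hV : 0 < V z.2.2) : z.1 = reducedLogX V z.2 := by
  rw [reducedLogX, ← exp_of_constraint hc hV, Real.log_exp]
  ring

lemma contDiffAt_reducedRate {V : ℝ → ℝ} (hV : ContDiff ℝ 3 V) {c : ℝ} (hc : 0 < V c) :
    ContDiffAt ℝ 1 (reducedRate V) (0, c) := by
  have h1 : ContDiff ℝ 1 (deriv V) := (hV.of_le (by norm_num : (1 + 1 : WithTop ℕ∞) ≤ 3)).deriv'
  have h2 : ContDiff ℝ 1 V := hV.of_le (by norm_num)
  unfold reducedRate
  have h3 : 3 * V ((0 : ℝ), c).2 ≠ 0 := by simpa using hc.ne'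
  have hnum : ContDiff ℝ 1 fun q : ℝ × ℝ => √(3 / 2) * deriv V q.2 := by fun_prop
  have hden : ContDiff ℝ 1 fun q : ℝ × ℝ => 3 * V q.2 := by fun_prop
  have hfac : ContDiff ℝ 1 fun q : ℝ × ℝ => 1 - q.1 ^ 2 := by fun_prop
  exact (hfac.contDiffAt.mul
    (contDiffAt_fst.add (hnum.contDiffAt.div hden.contDiffAt h3))).neg

lemma contDiffAt_reducedLogX {V : ℝ → ℝ} (hV : ContDiff ℝ 3 V) {c : ℝ} (hc : 0 < V c) :
    ContDiffAt ℝ 1 (reducedLogX V) (0, c) := by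
  have h2 : ContDiff ℝ 1 V := hV.of_le (by norm_num)
  unfold reducedLogX
  have h3 : 3 * V ((0 : ℝ), c).2 ≠ 0 := by simpa using hc.ne'
  have hden : ContDiff ℝ 1 fun q : ℝ × ℝ => 3 * V q.2 := by fun_prop
  have hfac : ContDiff ℝ 1 fun q : ℝ × ℝ => 1 - q.1 ^ 2 := by fun_prop
  refine ((hfac.contDiffAt.div hden.contDiffAt h3).log ?_).div_const 2
  simpa using hc.ne'

/-- The coefficient `-1` of the `y` direction is the friction term; it gives the linearization the
form `u' = -u - k v` required by the cone estimate. -/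
lemma fderiv_reducedRate_apply {V : ℝ → ℝ} (hV : ContDiff ℝ 3 V) {c : ℝ} (hc : 0 < V c)
    (hc' : deriv V c = 0) (q : ℝ × ℝ) :
    fderiv ℝ (reducedRate V) (0, c) q
      = -q.1 + fderiv ℝ (reducedRate V) (0, c) (0, 1) * q.2 := by
  set A := fderiv ℝ (reducedRate V) (0, c) with hA
  have hd : HasFDerivAt (reducedRate V) A (0, c) :=
    ((contDiffAt_reducedRate hV hc).differentiableAt one_ne_zero).hasFDerivAt
  have h1 : A (1, 0) = -1 := by
    have h2 : HasDerivAt (fun t : ℝ => (t, c)) ((1 : ℝ), (0 : ℝ)) 0 :=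
      (hasDerivAt_id (0 : ℝ)).prodMk (hasDerivAt_const _ _)
    have h3 := hd.comp_hasDerivAt (0 : ℝ) h2
    have h4 : HasDerivAt (fun t : ℝ => -((1 - t ^ 2) * t)) (-1) 0 := by
      have := ((((hasDerivAt_id (0 : ℝ)).pow 2).const_sub 1).mul (hasDerivAt_id (0 : ℝ))).neg
      exact this.congr_deriv (by simp)
    refine h3.unique (h4.congr_of_eventuallyEq (Eventually.of_forall fun t => ?_))
    simp [reducedRate, hc']
  have h5 : q = q.1 • ((1 : ℝ), (0 : ℝ)) + q.2 • ((0 : ℝ), (1 : ℝ)) := by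
    ext <;> simp
  conv_lhs => rw [h5]
  rw [map_add, map_smul, map_smul, h1, smul_eq_mul, smul_eq_mul]
  ring

/-- Near a de Sitter equilibrium, the states whose past orbits stay nearby form a Lipschitz
curve parametrized by the scalar field. -/
lemma exists_local_past_bound {V : ℝ → ℝ} (hV : ContDiff ℝ 3 V) {c : ℝ} (hc : 0 < V c)
    (hc' : deriv V c = 0) :
    ∃ r > 0, ∃ C : NNReal, ∀ T ≤ 0, ∀ z w : ℝ → ℝ × ℝ × ℝ,
      IsTrajectoryOn V z (Set.Iic 0) → IsTrajectoryOn V w (Set.Iic 0) →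
      (∀ τ ≤ 0, constraint V (z τ) = 1) → (∀ τ ≤ 0, constraint V (w τ) = 1) →
      (∀ τ ≤ T, (z τ).2 ∈ Metric.ball (0, c) r) → (∀ τ ≤ T, (w τ).2 ∈ Metric.ball (0, c) r) →
      dist (z T) (w T) ≤ C * dist (z T).2.2 (w T).2.2 := by
  set A := fderiv ℝ (reducedRate V) (0, c) with hA
  set s : ℝ := √(2 / 3) with hs
  have hs0 : 0 < s := sqrt_two_thirds_pos
  have hs1 : s ≤ 1 := sqrt_two_thirds_le_one
  obtain ⟨ε, hε, L, hL⟩ := exists_cone_bound (-A (0, 1) * s)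
  -- Strict differentiability controls differences of the rate at two nearby points, so the
  -- difference of two orbits solves the linear system up to an error `ε`.
  have hstrict : HasStrictFDerivAt (reducedRate V) A (0, c) :=
    (contDiffAt_reducedRate hV hc).hasStrictFDerivAt one_ne_zero
  obtain ⟨S₁, hS₁, happ⟩ := hstrict.approximates_deriv_on_nhds (c := ⟨ε, hε.le⟩) (Or.inr hε)
  obtain ⟨K, S₂, hS₂, hlip⟩ := (contDiffAt_reducedLogX hV hc).exists_lipschitzOnWith
  have hS₃ : {q : ℝ × ℝ | 0 < V q.2} ∈ 𝓝 ((0 : ℝ), c) :=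
    (hV.continuous.comp continuous_snd).continuousAt.eventually (lt_mem_nhds hc)
  obtain ⟨r, hr, hball⟩ := Metric.mem_nhds_iff.1 (inter_mem (inter_mem hS₁ hS₂) hS₃)
  set L' := |L| / s with hL'
  have hL'0 : 0 ≤ L' := by positivity
  refine ⟨r, hr, ⟨(K + 1) * (L' + 1), by positivity⟩, ?_⟩
  intro T hT z w hz hw hzc hwc hzr hwr
  have hdist : ∀ τ ≤ T, dist (z τ).2 (w τ).2 ≤ 2 * r := fun τ hτ => by
    have h1 := Metric.mem_ball.1 (hzr τ hτ)
    have h2 := Metric.mem_ball.1 (hwr τ hτ)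
    linarith [dist_triangle_right (z τ).2 (w τ).2 (0, c)]
  have hyT : |(z T).2.1 - (w T).2.1| ≤ L * |((z T).2.2 - (w T).2.2) / s| := by
    -- Dividing the `φ` difference by `s = √(2/3)` turns its equation into exactly `v' = u`.
    refine hL T (2 * r / s) (fun τ => (z τ).2.1 - (w τ).2.1)
      (fun τ => ((z τ).2.2 - (w τ).2.2) / s)
      (fun τ => (chartField V (z τ)).2.1 - (chartField V (w τ)).2.1) ?_ ?_ ?_ ?_ ?_ ?_ ?_
    · exact (hz.continuousOn.snd.fst.sub hw.continuousOn.snd.fst).mono (Set.Iic_subset_Iic.2 hT)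
    · exact ((hz.continuousOn.snd.snd.sub hw.continuousOn.snd.snd).div_const s).mono
        (Set.Iic_subset_Iic.2 hT)
    · exact fun τ hτ => (hz.hasDerivAt_y (hτ.trans_le hT)).sub (hw.hasDerivAt_y (hτ.trans_le hT))
    · intro τ hτ
      have := ((hz.hasDerivAt_field (hτ.trans_le hT)).sub
        (hw.hasDerivAt_field (hτ.trans_le hT))).div_const s
      refine this.congr_deriv ?_
      rw [← hs]
      field_simp
    · intro τ hτ
      have hz1 := hball (hzr τ hτ.le)
      have hw1 := hball (hwr τ hτ.le)
      have h1 := happ _ hz1.1.1 _ hw1.1.1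
      have hτ0 : τ ≤ 0 := hτ.le.trans hT
      rw [fderiv_reducedRate_apply hV hc hc', ← hA,
        ← chartField_eq_reducedRate (hzc τ hτ0) hz1.2,
        ← chartField_eq_reducedRate (hwc τ hτ0) hw1.2, Real.norm_eq_abs] at h1
      have h2 : ‖(z τ).2 - (w τ).2‖ ≤
          |(z τ).2.1 - (w τ).2.1| + |((z τ).2.2 - (w τ).2.2) / s| := by
        rw [Prod.norm_def, abs_div, abs_of_pos hs0]
        have h3 : |(z τ).2.2 - (w τ).2.2| ≤ |(z τ).2.2 - (w τ).2.2| / s :=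
          le_div_self (abs_nonneg _) hs0 hs1
        have h4 := abs_nonneg ((z τ).2.2 - (w τ).2.2)
        have h5 := abs_nonneg ((z τ).2.1 - (w τ).2.1)
        exact max_le (by simpa using h4.trans h3) (by simpa using (h3.trans (by linarith)))
      refine (le_of_eq ?_).trans (h1.trans (mul_le_mul_of_nonneg_left h2 hε.le))
      congr 1
      simp only [Prod.fst_sub, Prod.snd_sub]
      field_simp
      ring
    · intro τ hτ
      have h1 := (le_max_left _ _).trans (hdist τ hτ)
      refine h1.trans (le_div_self (by positivity) hs0 hs1)
    · intro τ hτ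
      have h1 := (le_max_right _ _).trans (hdist τ hτ)
      rw [abs_div, abs_of_pos hs0]
      gcongr
      exact h1
  set δ := dist (z T).2.2 (w T).2.2 with hδ
  have hδ0 : 0 ≤ δ := dist_nonneg
  have hy : dist (z T).2.1 (w T).2.1 ≤ L' * δ := by
    rw [Real.dist_eq]
    refine hyT.trans ?_
    rw [abs_div, abs_of_pos hs0, hL', hδ, Real.dist_eq, div_mul_eq_mul_div, mul_div_assoc']
    gcongr
    exact le_abs_self L
  have hsnd : dist (z T).2 (w T).2 ≤ (L' + 1) * δ := by
    rw [Prod.dist_eq]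
    exact max_le (hy.trans (by nlinarith)) (by nlinarith)
  have hz1 := hball (hzr T le_rfl)
  have hw1 := hball (hwr T le_rfl)
  have hfst : dist (z T).1 (w T).1 ≤ K * dist (z T).2 (w T).2 := by
    rw [fst_eq_reducedLogX (hzc T hT) hz1.2, fst_eq_reducedLogX (hwc T hT) hw1.2]
    exact hlip.dist_le_mul _ hz1.1.2 _ hw1.1.2
  change dist (z T) (w T) ≤ (K + 1) * (L' + 1) * δ
  rw [Prod.dist_eq]
  have hK : (0 : ℝ) ≤ K := K.2
  have h1 : (K : ℝ) * dist (z T).2 (w T).2 ≤ K * ((L' + 1) * δ) := by gcongr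
  have h2 : 0 ≤ (L' + 1) * δ := by positivity
  have h3 : 0 ≤ K * ((L' + 1) * δ) := by positivity
  exact max_le (by nlinarith) (by nlinarith)

/-! ### Measure zero and conclusion -/

/-- A set that is parametrized in a Lipschitz way by a subset of the line has vanishing
two-dimensional Hausdorff measure. -/
lemma hausdorffMeasure_two_eq_zero {S : Set State} {w : S → ℝ} {C : NNReal}
    (h : ∀ p q : S, dist p q ≤ C * dist (w p) (w q)) :
    (Measure.hausdorffMeasure 2 : Measure State) S = 0 := by
  have hw : AntilipschitzWith C w := AntilipschitzWith.of_le_mul_dist h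
  have h1 := hw.le_hausdorffMeasure_image (d := 2) zero_le_two Set.univ
  have h2 : (Measure.hausdorffMeasure 2 : Measure ℝ) (w '' Set.univ) = 0 := by
    refine hausdorffMeasure_of_dimH_lt (d := 2)
      ((dimH_mono (Set.subset_univ _)).trans_lt ?_)
    rw [Real.dimH_univ]
    norm_num
  have h3 := (isometry_subtype_coe (s := S)).hausdorffMeasure_image (d := 2)
    (Or.inl zero_le_two) Set.univ
  rw [Set.image_univ, Subtype.range_coe] at h3
  rw [h3]
  rw [h2, mul_zero] at h1
  exact le_antisymm h1 bot_le

/-- The states whose past trajectory stays in the ball of radius `R` and, up to time `T`, has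
`(y, φ)` in the ball of radius `r` around `(0, c)`. -/
def trappedStates (V : ℝ → ℝ) (c r T R : ℝ) : Set State :=
  {p | ∃ z : ℝ → ℝ × ℝ × ℝ, toState (z 0) = p ∧ IsTrajectoryOn V z (Set.Iic 0) ∧
    (∀ τ ≤ 0, constraint V (z τ) = 1) ∧ (∀ τ ≤ 0, z τ ∈ Metric.closedBall 0 R) ∧
    ∀ τ ≤ T, (z τ).2 ∈ Metric.ball (0, c) r}

/-- The value of `φ` at time `T` parametrizes the set: it controls the state at `T` by the local
bound, and the flow from `T` to `0` within the ball of radius `R` is Lipschitz. -/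
lemma exists_trappedStates_null {V : ℝ → ℝ} (hV : ContDiff ℝ 3 V) {c : ℝ} (hc : 0 < V c)
    (hc' : deriv V c = 0) : ∃ r > 0, ∀ T ≤ 0, ∀ R,
      (Measure.hausdorffMeasure 2 : Measure State) (trappedStates V c r T R) = 0 := by
  obtain ⟨r, hr, C, hC⟩ := exists_local_past_bound hV hc hc'
  refine ⟨r, hr, fun T hT R => ?_⟩
  obtain ⟨K₁, hK₁⟩ := exists_lipschitzOnWith_closedBall contDiff_toState R
  obtain ⟨K₂, hK₂⟩ := exists_dist_trajectory_le hV R (-T)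
  choose z hz0 hz hzc hzR hzr using fun p : trappedStates V c r T R => p.2
  refine hausdorffMeasure_two_eq_zero (w := fun p => (z p T).2.2) (C := K₁ * (K₂ * C))
    fun p q => ?_
  have h1 := hK₁.dist_le_mul _ (hzR p 0 le_rfl) _ (hzR q 0 le_rfl)
  rw [hz0, hz0] at h1
  have h2 := hK₂ T 0 hT (by simp) (z p) (z q) ((hz p).mono Set.Icc_subset_Iic_self)
    ((hz q).mono Set.Icc_subset_Iic_self) (fun τ hτ => hzR p τ hτ.2) (fun τ hτ => hzR q τ hτ.2)
  have h3 := hC T hT (z p) (z q) (hz p) (hz q) (hzc p) (hzc q) (hzr p) (hzr q)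
  calc dist p q ≤ K₁ * dist (z p 0) (z q 0) := h1
    _ ≤ K₁ * (K₂ * dist (z p T) (z q T)) := by gcongr
    _ ≤ K₁ * (K₂ * (C * dist (z p T).2.2 (z q T).2.2)) := by gcongr
    _ = (K₁ * (K₂ * C) : NNReal) * dist (z p T).2.2 (z q T).2.2 := by push_cast; ring

lemma exists_bounded_trajectory {V : ℝ → ℝ} (hV : ContDiff ℝ 3 V) (hV0 : ∀ s, 0 ≤ V s)
    {p : State} (hp : p ∈ phaseSpace V) (hb : FieldBoundedOnPast V p) :
    ∃ (z : ℝ → ℝ × ℝ × ℝ) (M : ℝ), toState (z 0) = p ∧ IsTrajectoryOn V z (Set.Iic 0) ∧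
      (∀ τ ≤ 0, constraint V (z τ) = 1) ∧ ∀ τ ≤ 0, |(z τ).2.2| ≤ M := by
  obtain ⟨z, hz0, hz, hc⟩ := exists_trajectory_Iic hV hV0 (constraint_chart hp)
  obtain ⟨M, hM⟩ := hb
  have h0 : toState (z 0) = p := by rw [hz0, toState_chart hp]
  refine ⟨z, M, h0, hz, hc, fun τ hτ => ?_⟩
  exact hM (toState (z τ)) ⟨τ, hτ, fun s => toState (z s),
    isSolutionOn_toState (hz.mono Set.Icc_subset_Iic_self) (fun s hs => hc s hs.2), h0, rfl⟩

lemma hausdorffMeasure_fieldBounded {V : ℝ → ℝ} (hV : ContDiff ℝ 3 V) (hV0 : ∀ s, 0 ≤ V s) :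
    (Measure.hausdorffMeasure 2 : Measure State)
      {p | p ∈ phaseSpace V ∧ FieldBoundedOnPast V p} = 0 := by
  set E : Set ℝ := {c | 0 < V c ∧ deriv V c = 0} with hE
  have hloc : ∀ c, ∃ r : ℝ, c ∈ E → 0 < r ∧ ∀ T ≤ 0, ∀ R,
      (Measure.hausdorffMeasure 2 : Measure State) (trappedStates V c r T R) = 0 := by
    intro c
    by_cases hc : c ∈ E
    · obtain ⟨r, hr, h⟩ := exists_trappedStates_null hV hc.1 hc.2
      exact ⟨r, fun _ => ⟨hr, h⟩⟩
    -- Dummy radius away from the critical points.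
    · exact ⟨0, fun h => absurd h hc⟩
  choose r hr using hloc
  -- The critical points may be uncountable; by the Lindelöf property countably many of the balls
  -- cover them all.
  obtain ⟨t, htE, htc, ht⟩ := TopologicalSpace.countable_cover_nhdsWithin
    (f := fun c => Metric.ball c (r c)) (s := E)
    (fun c hc => mem_nhdsWithin_of_mem_nhds (Metric.ball_mem_nhds c (hr c hc).1))
  have hnull : (Measure.hausdorffMeasure 2 : Measure State)
      (⋃ c ∈ t, ⋃ n : ℕ, ⋃ m : ℕ, trappedStates V c (r c) (-(n : ℝ)) m) = 0 := by
    rw [measure_biUnion_null_iff htc]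
    intro c hc
    rw [measure_iUnion_null_iff]
    intro n
    rw [measure_iUnion_null_iff]
    exact fun m => (hr c (htE hc)).2 _ (by simp) _
  refine measure_mono_null ?_ hnull
  rintro p ⟨hp, hb⟩
  obtain ⟨z, M, hz0, hz, hzc, hzM⟩ := exists_bounded_trajectory hV hV0 hp hb
  obtain ⟨l, d, hlim, hd, hd'⟩ := hz.exists_tendsto hV hV0 hzc hzM
  obtain ⟨R, hR⟩ := hz.exists_norm_le_past hV hV0 hzc hzM
  -- If `V d = 0`, the constraint at the limit, where `y = 0`, would read `0 = 1`.
  have hdV : 0 < V d := by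
    refine (hV0 d).lt_of_ne fun h => ?_
    simp [constraint, ← h] at hd
  obtain ⟨c, hct, hdc⟩ := Set.mem_iUnion₂.1 (ht ⟨hdV, hd'⟩)
  have hnear : ∀ᶠ τ in atBot, (z τ).2 ∈ Metric.ball (0, c) (r c) := by
    have h1 : Tendsto (fun τ => (z τ).2) atBot (𝓝 (0, d)) := (continuous_snd.tendsto _).comp hlim
    refine h1.eventually (Metric.isOpen_ball.mem_nhds ?_)
    rw [Metric.mem_ball, Prod.dist_eq, dist_self]
    exact max_lt (hr c (htE hct)).1 hdc
  obtain ⟨T, hT⟩ := eventually_atBot.1 hnear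
  obtain ⟨n, hn⟩ := exists_nat_ge (-T)
  obtain ⟨m, hm⟩ := exists_nat_ge R
  refine Set.mem_iUnion₂.2 ⟨c, hct, Set.mem_iUnion₂.2 ⟨n, m, z, hz0, hz, hzc, ?_, ?_⟩⟩
  · exact fun τ hτ => Metric.closedBall_subset_closedBall hm (hR τ hτ)
  · exact fun τ hτ => hT τ (by linarith)

lemma measurableSet_phaseSpace {V : ℝ → ℝ} (hV : Continuous V) :
    MeasurableSet (phaseSpace V) := by
  have h0 : Continuous expansion := by unfold expansion; fun_prop
  have h1 : Continuous field := by unfold field; fun_prop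
  have h2 : Continuous velocity := by unfold velocity; fun_prop
  exact (isOpen_lt continuous_const h0).measurableSet.inter
    (isClosed_eq (by fun_prop) (by fun_prop)).measurableSet

lemma exists_deSitter_limit {V : ℝ → ℝ} (hV : ContDiff ℝ 3 V) (hV0 : ∀ s, 0 ≤ V s)
    {p : State} (hp : p ∈ phaseSpace V) (hb : FieldBoundedOnPast V p) :
    ∃ q : State, IsEquilibrium V q ∧ 0 < V (field q) ∧ deriv V (field q) = 0 ∧
      expansion q = √(3 * V (field q)) ∧ velocity q = 0 ∧ PastAsymptotic V p q := by
  obtain ⟨z, M, hz0, hz, hzc, hzM⟩ := exists_bounded_trajectory hV hV0 hp hb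
  obtain ⟨l, c, hlim, hc, hc'⟩ := hz.exists_tendsto hV hV0 hzc hzM
  have hcV : 0 < V c := by
    refine (hV0 c).lt_of_ne fun h => ?_
    simp [constraint, ← h] at hc
  have hmem : toState (l, 0, c) ∈ phaseSpace V := (toState_mem_phaseSpace V _).2 hc
  refine ⟨toState (l, 0, c), ⟨hmem, ?_, ?_, ?_⟩, hcV, hc', ?_, ?_,
    fun τ => toState (z τ), isSolutionOn_toState hz hzc, hz0,
    (contDiff_toState.continuous.tendsto _).comp hlim⟩
  · simp [xRate]
  · simp [yRate, hc']
  · simp [fieldRate]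
  · rw [← Real.sqrt_sq hmem.1.le, hmem.2]
    simp
  · simp

end FlatFRW

theorem mainTheorem4 (V : ℝ → ℝ) (hV : ContDiff ℝ 3 V) (hV0 : ∀ s : ℝ, 0 ≤ V s) :
    (∀ᵐ p ∂((Measure.hausdorffMeasure 2 : Measure FlatFRW.State).restrict
        (FlatFRW.phaseSpace V)), ¬ FlatFRW.FieldBoundedOnPast V p) ∧
    (Measure.hausdorffMeasure 2 : Measure FlatFRW.State)
        {p | p ∈ FlatFRW.phaseSpace V ∧ FlatFRW.FieldBoundedOnPast V p} = 0 ∧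
    ∀ p ∈ FlatFRW.phaseSpace V, FlatFRW.FieldBoundedOnPast V p →
      ∃ q : FlatFRW.State, FlatFRW.IsEquilibrium V q ∧
        0 < V (FlatFRW.field q) ∧ deriv V (FlatFRW.field q) = 0 ∧
        FlatFRW.expansion q = √(3 * V (FlatFRW.field q)) ∧ FlatFRW.velocity q = 0 ∧
        FlatFRW.PastAsymptotic V p q := by
  have hnull := FlatFRW.hausdorffMeasure_fieldBounded hV hV0
  refine ⟨?_, hnull, fun p hp hb => FlatFRW.exists_deSitter_limit hV hV0 hp hb⟩
  rw [ae_restrict_iff' (FlatFRW.measurableSet_phaseSpace hV.continuous), ae_iff]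
  refine measure_mono_null (fun p hp => ?_) hnull
  simpa using hp
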